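/- \textbf{Conventions.} For a topological space $X$, let $\operatorname{dens}(X)$ denote the density character of $X$, i.e. the smallest cardinality of a dense subset of $X$. A map $f\colon X\to Y$ between topological spaces is called \emph{density-surjective} if there is a subset $Z\subset X$ (with the subspace topology) such that $\operatorname{dens}(Z)=\operatorname{dens}(Y)$ and $f|_Z\colon Z\to Y$ is surjective. If $f\colon M\to N$ is a $C^1$ map between Banach manifolds, a point $x\in M$ is a \emph{regular point} of $f$ if the derivative $df(x)\colon T_xM\to T_{f(x)}N$ is onto; a point $y\in N$ is a \emph{regular value} of $f$ if every $x\in f^{-1}(y)$ is a regular point, and a \emph{critical value} of $f$ otherwise. \textbf{Corollary.} Let $M$ and $N$ be paracompact Hausdorff $C^1$ manifolds (without boundary) modelled on real Banach spaces $E$ and $F$ respectively, and let $f\colon M\to N$ be a $C^1$ surjection whose set of critical values is countable. Then $f$ is density-surjective. -/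

import Mathlib

open scoped Manifold ContDiff

universe u v

/-- The density character of a topological space: the smallest cardinality of a dense subset. -/
noncomputable def dens (X : Type u) [TopologicalSpace X] : Cardinal.{u} :=
  sInf {c | ∃ s : Set X, Dense s ∧ Cardinal.mk s = c}

/-- A map `f : X → Y` is density-surjective if there is a subset `Z` of `X`, with the subspace
topology, whose density character is that of `Y` and such that `f` restricted to `Z` is onto. -/
def DensitySurjective {X : Type u} {Y : Type v} [TopologicalSpace X] [TopologicalSpace Y]
    (f : X → Y) : Prop :=
  ∃ Z : Set X, Cardinal.lift.{v} (dens Z) = Cardinal.lift.{u} (dens Y) ∧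
    Function.Surjective (Z.domRestrict f)

/-- `x` is a regular point of `f : M → N` if the derivative `T_x M → T_{f x} N` is onto. -/
def IsRegularPoint (E F : Type*) {M N : Type*}
    [NormedAddCommGroup E] [NormedSpace ℝ E] [NormedAddCommGroup F] [NormedSpace ℝ F]
    [TopologicalSpace M] [ChartedSpace E M] [TopologicalSpace N] [ChartedSpace F N]
    (f : M → N) (x : M) : Prop :=
  Function.Surjective (mfderiv 𝓘(ℝ, E) 𝓘(ℝ, F) f x)

/-- `y` is a regular value of `f : M → N` if every point of its fibre is a regular point. -/
def IsRegularValue (E F : Type*) {M N : Type*}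
    [NormedAddCommGroup E] [NormedSpace ℝ E] [NormedAddCommGroup F] [NormedSpace ℝ F]
    [TopologicalSpace M] [ChartedSpace E M] [TopologicalSpace N] [ChartedSpace F N]
    (f : M → N) (y : N) : Prop :=
  ∀ x, f x = y → IsRegularPoint E F f x

/-- The critical values of `f : M → N` are the points of `N` that are not regular values. -/
def criticalValues (E F : Type*) {M N : Type*}
    [NormedAddCommGroup E] [NormedSpace ℝ E] [NormedAddCommGroup F] [NormedSpace ℝ F]
    [TopologicalSpace M] [ChartedSpace E M] [TopologicalSpace N] [ChartedSpace F N]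
    (f : M → N) : Set N :=
  {y | ¬ IsRegularValue E F f y}

open Set Filter Topology

/-! Let `D` be a dense subset of `N` of least cardinality. If `D` is finite, it is all of `N` and
chosen preimages suffice. Otherwise, at a regular point the derivative stays onto on a closed
subspace with a dense family indexed by `D`, obtained by lifting a dense subgroup of `F` with norm
control (`ContinuousLinearMap.exists_surjective_restrict`). By local surjectivity, `f` maps a small
slice in this subspace's directions onto a neighbourhood of the value
(`IsRegularPoint.exists_denselyIndexed`).

There may be more than `#D` regular values, so one slice per value is too many. Paracompactness
gives a network of `N` indexed by `D` (`DenseRange.exists_network`), and one slice per network set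
suffices. Countably many critical values cost one point each. The union still has a dense family
indexed by `D`; its density is no smaller than that of `N`, since continuous surjections do not
raise density. -/

/-- The set `S` contains a family indexed by `ι` that is dense in it. -/
def DenselyIndexed (ι : Type*) {X : Type*} [TopologicalSpace X] (S : Set X) : Prop :=
  ∃ h : ι → X, range h ⊆ S ∧ S ⊆ closure (range h)

/-! ### Sets with a dense family of prescribed size -/

section DenselyIndexed

variable {ι κ X Y : Type*} [TopologicalSpace X] [TopologicalSpace Y]

theorem DenselyIndexed.image {S : Set X} (hS : DenselyIndexed ι S) {s : X → Y}
    (hs : ContinuousOn s S) : DenselyIndexed ι (s '' S) := by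
  obtain ⟨h, h1, h2⟩ := hS
  refine ⟨s ∘ h, ?_, ?_⟩
  · rw [range_comp]
    exact image_mono h1
  · rintro _ ⟨x, hx, rfl⟩
    rw [range_comp]
    exact ((hs x hx).mono h1).mem_closure_image (h2 hx)

theorem DenseRange.denselyIndexed_of_isOpen {k : ι → X} (hk : DenseRange k) {O : Set X}
    (hO : IsOpen O) (hne : O.Nonempty) : DenselyIndexed ι O := by
  classical
  obtain ⟨x₀, hx₀⟩ := hne
  -- The default `x₀` keeps the index type equal to `ι`.
  refine ⟨fun i ↦ if k i ∈ O then k i else x₀, ?_, ?_⟩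
  · rintro _ ⟨i, rfl⟩
    dsimp only
    split_ifs with h
    exacts [h, hx₀]
  · intro x hx
    rw [mem_closure_iff]
    intro U hU hxU
    obtain ⟨i, hi⟩ := hk.exists_mem_open (hU.inter hO) ⟨x, hxU, hx⟩
    exact ⟨k i, hi.1, i, if_pos hi.2⟩

theorem DenselyIndexed.iUnion {P : κ → Set X} (hP : ∀ i, DenselyIndexed ι (P i))
    (e : ι ≃ κ × ι) : DenselyIndexed ι (⋃ i, P i) := by
  choose h h1 h2 using hP
  refine ⟨fun i ↦ h (e i).1 (e i).2, ?_, ?_⟩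
  · rintro _ ⟨i, rfl⟩
    exact mem_iUnion.2 ⟨_, h1 _ (mem_range_self _)⟩
  · refine iUnion_subset fun i ↦ (h2 i).trans (closure_mono ?_)
    rintro _ ⟨j, rfl⟩
    exact ⟨e.symm (i, j), by simp⟩

theorem denselyIndexed_singleton [Nonempty ι] (x : X) : DenselyIndexed ι {x} :=
  ⟨fun _ ↦ x, by simp, by rw [range_const]; exact subset_closure⟩

theorem Infinite.nonempty_equiv_prod_nat (ι : Type*) [Infinite ι] : Nonempty (ι ≃ ι × ℕ) := by
  rw [← Cardinal.lift_mk_eq']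
  simp

theorem Infinite.nonempty_equiv_prod_self (ι : Type*) [Infinite ι] : Nonempty (ι ≃ ι × ι) := by
  rw [← Cardinal.lift_mk_eq']
  simp

theorem Infinite.nonempty_equiv_sum_nat (ι : Type*) [Infinite ι] : Nonempty (ι ≃ ι ⊕ ℕ) := by
  rw [← Cardinal.lift_mk_eq']
  simp [Cardinal.add_eq_left (Cardinal.aleph0_le_mk ι) (Cardinal.aleph0_le_mk ι)]

theorem Infinite.nonempty_equiv_list (ι : Type*) [Infinite ι] : Nonempty (ι ≃ List ι) := by
  rw [← Cardinal.lift_mk_eq']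
  simp

end DenselyIndexed

/-! ### Small closed subspaces on which an operator stays onto -/

section Linear

variable {ι E F : Type*} [NormedAddCommGroup E] [NormedSpace ℝ E]
  [NormedAddCommGroup F] [NormedSpace ℝ F]

/-- Finite sums of rational multiples of members of a family are a family of the same size. -/
theorem exists_range_eq_addSubgroup_closure_rat_smul [Infinite ι] (e : ι → E) :
    ∃ k : ι → E, range k =
      (AddSubgroup.closure (range fun p : ι × ℚ ↦ (p.2 : ℝ) • e p.1) : Set E) := by
  obtain ⟨e₁⟩ := Infinite.nonempty_equiv_list ι
  obtain ⟨e₂⟩ := Infinite.nonempty_equiv_prod_nat ι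
  let e₃ : ι ≃ ι × ℚ := e₂.trans ((Equiv.refl ι).prodCongr (Denumerable.eqv ℚ).symm)
  let g : ι → E := fun i ↦ ((e₃ i).2 : ℝ) • e (e₃ i).1
  have hg : range g = range fun p : ι × ℚ ↦ (p.2 : ℝ) • e p.1 :=
    e₃.surjective.range_comp (fun p : ι × ℚ ↦ (p.2 : ℝ) • e p.1)
  refine ⟨fun i ↦ ((e₁ i).map g).sum, ?_⟩
  rw [← hg]
  apply Subset.antisymm
  · rintro _ ⟨i, rfl⟩
    refine list_sum_mem fun x hx ↦ ?_
    obtain ⟨j, -, rfl⟩ := List.mem_map.1 hx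
    exact AddSubgroup.subset_closure (mem_range_self j)
  · intro x hx
    suffices ∃ l : List ι, (l.map g).sum = x by
      obtain ⟨l, hl⟩ := this
      exact ⟨e₁.symm l, by simpa using hl⟩
    -- The generators are stable under negation, so plain list sums exhaust the subgroup.
    have hneg : ∀ i, ∃ j, g j = - g i := fun i ↦
      ⟨e₃.symm ((e₃ i).1, -(e₃ i).2), by simp [g]⟩
    choose ν hν using hneg
    induction hx using AddSubgroup.closure_induction with
    | mem x hx =>
      obtain ⟨i, rfl⟩ := hx
      exact ⟨[i], by simp⟩
    | zero => exact ⟨[], by simp⟩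
    | add x y _ _ hx hy =>
      obtain ⟨l, rfl⟩ := hx
      obtain ⟨l', rfl⟩ := hy
      exact ⟨l ++ l', by simp⟩
    | neg x _ hx =>
      obtain ⟨l, rfl⟩ := hx
      have hgν : g ∘ ν = Neg.neg ∘ g := funext hν
      refine ⟨l.map ν, ?_⟩
      rw [List.map_map, hgν, ← List.map_map, List.sum_neg]

/-- Rational scalars preserve the subgroup, so by density of `ℚ` in `ℝ` real scalars preserve its
closure, which is therefore a subspace. -/
theorem span_subset_closure_addSubgroup_closure_rat_smul (e : ι → E) :
    (Submodule.span ℝ (range e) : Set E) ⊆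
      closure (AddSubgroup.closure (range fun p : ι × ℚ ↦ (p.2 : ℝ) • e p.1) : Set E) := by
  set G := AddSubgroup.closure (range fun p : ι × ℚ ↦ (p.2 : ℝ) • e p.1) with hG
  have hq : ∀ (q : ℚ) (x : E), x ∈ G → (q : ℝ) • x ∈ G := by
    intro q x hx
    induction hx using AddSubgroup.closure_induction with
    | mem x hx =>
      obtain ⟨p, rfl⟩ := hx
      refine AddSubgroup.subset_closure ⟨(p.1, q * p.2), ?_⟩
      simp [mul_smul]
    | zero => simp
    | add x y _ _ hx hy => rw [smul_add]; exact add_mem hx hy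
    | neg x _ hx => rw [smul_neg]; exact neg_mem hx
  have hr : ∀ (r : ℝ) (x : E), x ∈ closure (G : Set E) → r • x ∈ closure (G : Set E) := by
    intro r x hx
    have hcl : IsClosed {r : ℝ | r • x ∈ closure (G : Set E)} :=
      isClosed_closure.preimage (by fun_prop)
    refine Rat.denseRange_cast.induction_on (p := fun r : ℝ ↦ r • x ∈ closure (G : Set E)) r hcl
      fun q ↦ ?_
    exact map_mem_closure (continuous_const_smul (q : ℝ)) hx fun y hy ↦ hq q y hy
  intro x hx
  induction hx using Submodule.span_induction with
  | mem x hx =>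
    obtain ⟨i, rfl⟩ := hx
    exact subset_closure (AddSubgroup.subset_closure ⟨(i, 1), by simp⟩)
  | zero => exact subset_closure (zero_mem G)
  | add x y _ _ hx hy => exact add_mem (S := AddSubgroup E) (s := G.topologicalClosure) hx hy
  | smul r x _ hx => exact hr r x hx

/-- The closed linear span of an infinite family has a dense family indexed by the same type. -/
theorem exists_denseRange_topologicalClosure_span [Infinite ι] (e : ι → E) :
    ∃ k : ι → (Submodule.span ℝ (range e)).topologicalClosure, DenseRange k := by
  obtain ⟨k, hk⟩ := exists_range_eq_addSubgroup_closure_rat_smul e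
  have hsub := span_subset_closure_addSubgroup_closure_rat_smul e
  rw [← hk] at hsub
  have hmem : ∀ i, k i ∈ (Submodule.span ℝ (range e)).topologicalClosure := by
    intro i
    apply Submodule.le_topologicalClosure
    have hi : k i ∈ (AddSubgroup.closure (range fun p : ι × ℚ ↦ (p.2 : ℝ) • e p.1) : Set E) :=
      hk ▸ mem_range_self i
    have hle : AddSubgroup.closure (range fun p : ι × ℚ ↦ (p.2 : ℝ) • e p.1) ≤
        (Submodule.span ℝ (range e)).toAddSubgroup := by
      rw [AddSubgroup.closure_le]
      rintro _ ⟨p, rfl⟩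
      exact Submodule.smul_mem _ _ (Submodule.subset_span (mem_range_self _))
    exact hle hi
  refine ⟨fun i ↦ ⟨k i, hmem i⟩, fun x ↦ ?_⟩
  rw [closure_subtype, ← range_comp]
  exact closure_minimal hsub isClosed_closure x.2

/-- A surjective operator onto a space with a dense family indexed by `ι` is still onto when
restricted to a suitable closed subspace which has a dense family indexed by `ι`. -/
theorem ContinuousLinearMap.exists_surjective_restrict [Infinite ι] [CompleteSpace E] [CompleteSpace F]
    (T : E →L[ℝ] F) (hT : Function.Surjective T) {h : ι → F} (hh : DenseRange h) :
    ∃ E' : Submodule ℝ E, IsClosed (E' : Set E) ∧ (∃ k : ι → E', DenseRange k) ∧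
      Function.Surjective (T ∘L E'.subtypeL) := by
  obtain ⟨C, hC, hpre⟩ := T.exists_preimage_norm_le hT
  obtain ⟨k, hk⟩ := exists_range_eq_addSubgroup_closure_rat_smul h
  set K := AddSubgroup.closure (range fun p : ι × ℚ ↦ (p.2 : ℝ) • h p.1)
  choose e he1 he2 using fun i ↦ hpre (k i)
  refine ⟨(Submodule.span ℝ (range e)).topologicalClosure,
    Submodule.isClosed_topologicalClosure _, exists_denseRange_topologicalClosure_span e, ?_⟩
  set E' := (Submodule.span ℝ (range e)).topologicalClosure
  have : CompleteSpace E' := (Submodule.isClosed_topologicalClosure _).completeSpace_coe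
  let T' : E' →L[ℝ] F := T ∘L E'.subtypeL
  let f : NormedAddGroupHom E' F :=
    T'.toLinearMap.toAddMonoidHom.mkNormedAddGroupHom ‖T'‖ T'.le_opNorm
  have hf : f.SurjectiveOnWith K C := by
    intro y hy
    have hy' : y ∈ range k := hk ▸ hy
    obtain ⟨i, rfl⟩ := hy'
    exact ⟨⟨e i, Submodule.le_topologicalClosure _ (Submodule.subset_span (mem_range_self i))⟩,
      he1 i, he2 i⟩
  -- Each point of the closure of `K` is the sum of a rapidly convergent series in `K`. The lifts
  -- with norm bound `C` form a series that converges in the complete space `E'`.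
  have hf' := controlled_closure_of_complete hC one_pos hf
  intro y
  have hKd : y ∈ K.topologicalClosure := by
    refine closure_mono ?_ (hh y)
    rintro _ ⟨i, rfl⟩
    exact AddSubgroup.subset_closure ⟨(i, 1), by simp⟩
  obtain ⟨x, hx, -⟩ := hf' y hKd
  exact ⟨x, hx⟩

end Linear

/-! ### Density, networks and local surjectivity on manifolds -/

section Manifold

variable {ι E F : Type*} [Infinite ι] [NormedAddCommGroup E] [NormedSpace ℝ E]
  [NormedAddCommGroup F] [NormedSpace ℝ F]
  {M N : Type*} [TopologicalSpace M] [ChartedSpace E M] [TopologicalSpace N] [ChartedSpace F N]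

/-- A dense family in a nonempty manifold yields a dense family in its model space. -/
theorem DenseRange.exists_denseRange_model [Nonempty N] {h : ι → N} (hh : DenseRange h) :
    ∃ k : ι → F, DenseRange k := by
  obtain ⟨y₀⟩ := ‹Nonempty N›
  obtain ⟨e⟩ := Infinite.nonempty_equiv_prod_nat ι
  let c : OpenPartialHomeomorph N F := chartAt F y₀
  -- The chart image of the family is dense only near `c y₀`; dilating about that point by every `n
  -- + 1` fills `F`.
  let g : ι × ℕ → F := fun p ↦ ((p.2 : ℝ) + 1) • (c (h p.1) - c y₀)
  refine ⟨g ∘ e, ?_⟩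
  have hg : DenseRange g := by
    intro v
    rw [mem_closure_iff]
    intro U hU hvU
    have hlim : Tendsto (fun n : ℕ ↦ c y₀ + (1 / ((n : ℝ) + 1)) • v) atTop
        (𝓝 (c y₀ + (0 : ℝ) • v)) :=
      (tendsto_one_div_add_atTop_nhds_zero_nat.smul_const v).const_add _
    rw [zero_smul, add_zero] at hlim
    obtain ⟨n, hn⟩ := (hlim.eventually
      (c.open_target.mem_nhds (c.map_source (mem_chart_source F y₀)))).exists
    let q : F → F := fun w ↦ ((n : ℝ) + 1) • (w - c y₀)
    have hq : Continuous q := by fun_prop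
    have hqv : q (c y₀ + (1 / ((n : ℝ) + 1)) • v) = v := by
      have : ((n : ℝ) + 1) ≠ 0 := by positivity
      simp [q, smul_smul, this]
    have hopen : IsOpen (c.source ∩ c ⁻¹' (q ⁻¹' U)) :=
      c.isOpen_inter_preimage (hU.preimage hq)
    obtain ⟨i, hi⟩ := hh.exists_mem_open hopen
      ⟨c.symm (c y₀ + (1 / ((n : ℝ) + 1)) • v), c.map_target hn, by
        rw [mem_preimage, c.right_inv hn, mem_preimage, hqv]; exact hvU⟩
    exact ⟨g (i, n), hi.2, mem_range_self _⟩
  unfold DenseRange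
  rw [e.surjective.range_comp]
  exact hg

/-- A paracompact manifold with a dense family indexed by `ι` has a network indexed by `ι`. -/
theorem DenseRange.exists_network [Nonempty N] [ParacompactSpace N] {h : ι → N}
    (hh : DenseRange h) (F : Type*) [NormedAddCommGroup F] [ChartedSpace F N] :
    ∃ B : ι → Set N, ∀ y, ∀ U ∈ 𝓝 y, ∃ i, y ∈ B i ∧ B i ⊆ U := by
  obtain ⟨V, hVo, hVc, hVf, hVs⟩ := precise_refinement (fun a : N ↦ (chartAt F a).source)
    (fun a ↦ (chartAt F a).open_source)
    (iUnion_eq_univ_iff.2 fun y ↦ ⟨y, mem_chart_source F y⟩)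
  -- Each `h j` lies in finitely many `V a`, and every nonempty `V a` contains some `h j`, so pairs
  -- in `ι × ℕ` enumerate all the nonempty ones.
  have henum : ∀ j, ∃ c : ℕ → N, {a | h j ∈ V a} ⊆ range c := fun j ↦
    countable_iff_exists_subset_range.1 (hVf.point_finite (h j)).countable
  choose c hc using henum
  obtain ⟨e₁⟩ := Infinite.nonempty_equiv_prod_nat ι
  obtain ⟨e₂⟩ := Infinite.nonempty_equiv_prod_self ι
  let e : ι ≃ (ι × ℕ) × (ι × ℕ) := e₂.trans (e₁.prodCongr e₁)
  let B : (ι × ℕ) × (ι × ℕ) → Set N := fun p ↦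
    V (c p.1.1 p.1.2) ∩ {z | dist (chartAt F (c p.1.1 p.1.2) z)
      (chartAt F (c p.1.1 p.1.2) (h p.2.1)) < 1 / ((p.2.2 : ℝ) + 1)}
  suffices ∀ y, ∀ U ∈ 𝓝 y, ∃ p, y ∈ B p ∧ B p ⊆ U by
    refine ⟨B ∘ e, fun y U hU ↦ ?_⟩
    obtain ⟨p, hp⟩ := this y U hU
    exact ⟨e.symm p, by simpa using hp⟩
  intro y U hU
  obtain ⟨a, ha⟩ := iUnion_eq_univ_iff.1 hVc y
  obtain ⟨j, hj⟩ := hh.exists_mem_open (hVo a) ⟨y, ha⟩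
  obtain ⟨m, rfl⟩ := hc j hj
  set φ := chartAt F (c j m)
  have hyφ : y ∈ φ.source := hVs _ ha
  have hsymm : φ.symm ⁻¹' U ∈ 𝓝 (φ y) := by
    apply φ.continuousAt_symm (φ.map_source hyφ)
    rwa [φ.left_inv hyφ]
  obtain ⟨ε, hε, hball⟩ := Metric.mem_nhds_iff.1 hsymm
  obtain ⟨n, hn⟩ := exists_nat_one_div_lt (half_pos hε)
  have hO : IsOpen (φ.source ∩ φ ⁻¹' Metric.ball (φ y) (1 / ((n : ℝ) + 1))) :=
    φ.isOpen_inter_preimage Metric.isOpen_ball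
  obtain ⟨k, hk⟩ := hh.exists_mem_open hO
    ⟨y, hyφ, Metric.mem_ball_self (by positivity)⟩
  refine ⟨((j, m), (k, n)), ⟨ha, ?_⟩, ?_⟩
  · rw [mem_ofPred_eq, dist_comm]
    exact hk.2
  · rintro z ⟨hz1, hz2⟩
    have hzφ : z ∈ φ.source := hVs _ hz1
    have hz : φ z ∈ Metric.ball (φ y) ε := by
      have h1 : dist (φ z) (φ (h k)) < 1 / ((n : ℝ) + 1) := hz2
      have h2 : dist (φ (h k)) (φ y) < 1 / ((n : ℝ) + 1) := hk.2
      have := dist_triangle (φ z) (φ (h k)) (φ y)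
      rw [Metric.mem_ball]
      linarith
    have := hball hz
    rwa [mem_preimage, φ.left_inv hzφ] at this

/-- Near a regular point, a `C¹` map covers a neighbourhood of its value by the image of a set
which is no larger, in the sense of density, than the target. -/
theorem IsRegularPoint.exists_denselyIndexed [CompleteSpace E] [CompleteSpace F]
    {f : M → N} {x : M} (hf : ContMDiffAt 𝓘(ℝ, E) 𝓘(ℝ, F) 1 f x)
    (hx : IsRegularPoint E F f x) {h : ι → F} (hh : DenseRange h) :
    ∃ Z : Set M, DenselyIndexed ι Z ∧ f '' Z ∈ 𝓝 (f x) := by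
  let a := chartAt E x
  let b := chartAt F (f x)
  let φ : E → F := b ∘ f ∘ a.symm
  have hxa : x ∈ a.source := mem_chart_source E x
  have hfb : f x ∈ b.source := mem_chart_source F (f x)
  have hpa : a x ∈ a.target := a.map_source hxa
  have hφ : ContDiffAt ℝ 1 φ (a x) := by
    have := (contMDiffAt_iff.1 hf).2
    simpa [φ, a, b, contDiffWithinAt_univ] using this
  have hT : Function.Surjective (fderiv ℝ φ (a x)) := by
    have h1 := hx
    unfold IsRegularPoint at h1
    rw [(hf.mdifferentiableAt one_ne_zero).mfderiv] at h1
    simp only [writtenInExtChartAt, mfld_simps, fderivWithin_univ] at h1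
    exact h1
  obtain ⟨E', hE', ⟨k, hk⟩, hsurj⟩ := (fderiv ℝ φ (a x)).exists_surjective_restrict hT hh
  have : CompleteSpace E' := hE'.completeSpace_coe
  -- The affine slice through `a x` in the directions of `E'`.
  let τ : E' → E := fun v ↦ a x + v
  have hτc : Continuous τ := by fun_prop
  have hτ0 : τ 0 = a x := by simp [τ]
  have hτ : HasStrictFDerivAt τ E'.subtypeL 0 := E'.subtypeL.hasStrictFDerivAt.const_add (a x)
  have hψ : HasStrictFDerivAt (φ ∘ τ) (fderiv ℝ φ (a x) ∘L E'.subtypeL) 0 := by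
    refine HasStrictFDerivAt.comp 0 ?_ hτ
    rw [hτ0]
    exact hφ.hasStrictFDerivAt one_ne_zero
  have hmap := hψ.map_nhds_eq_of_surj (LinearMap.range_eq_top.2 hsurj)
  have hφx : φ (a x) = b (f x) := by simp [φ, a.left_inv hxa]
  rw [Function.comp_apply, hτ0, hφx] at hmap
  -- The slice must stay in the source chart and its image in the target chart, where `b` is
  -- injective.
  have hO : ∀ᶠ v in 𝓝 (0 : E'), τ v ∈ a.target ∧ f (a.symm (τ v)) ∈ b.source := by
    refine hτc.continuousAt.eventually (p := fun w ↦ w ∈ a.target ∧ f (a.symm w) ∈ b.source) ?_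
    rw [hτ0]
    refine Filter.Eventually.and (a.open_target.mem_nhds hpa) ?_
    have hcont : ContinuousAt (f ∘ a.symm) (a x) := by
      refine ContinuousAt.comp ?_ (a.continuousAt_symm hpa)
      rw [a.left_inv hxa]
      exact hf.continuousAt
    apply hcont
    rw [Function.comp_apply, a.left_inv hxa]
    exact b.open_source.mem_nhds hfb
  obtain ⟨O, hOsub, hOo, h0⟩ := mem_nhds_iff.1 hO
  refine ⟨(fun v ↦ a.symm (τ v)) '' O, ?_, ?_⟩
  · refine (hk.denselyIndexed_of_isOpen hOo ⟨0, h0⟩).image ?_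
    exact a.continuousOn_symm.comp hτc.continuousOn fun v hv ↦ (hOsub hv).1
  · have himg : (φ ∘ τ) '' O ∈ 𝓝 (b (f x)) := by
      rw [← hmap]
      exact image_mem_map (hOo.mem_nhds h0)
    filter_upwards [b.open_source.mem_nhds hfb, (b.continuousAt hfb) himg] with y hy hy'
    obtain ⟨v, hv, hvy⟩ := hy'
    exact ⟨_, ⟨v, hv, rfl⟩, b.injOn (hOsub hv).2 hy hvy⟩

end Manifold

/-! ### Comparison with the density character -/

section Density

variable {X : Type u} {Y : Type v} [TopologicalSpace X] [TopologicalSpace Y]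

theorem exists_dense_mk_eq_dens (X : Type u) [TopologicalSpace X] :
    ∃ s : Set X, Dense s ∧ Cardinal.mk s = dens X :=
  csInf_mem (s := {c | ∃ s : Set X, Dense s ∧ Cardinal.mk s = c}) ⟨_, univ, dense_univ, rfl⟩

theorem Dense.dens_le {s : Set X} (hs : Dense s) : dens X ≤ Cardinal.mk s :=
  csInf_le' ⟨s, hs, rfl⟩

theorem DenseRange.lift_dens_le {ι : Type v} {h : ι → X} (hh : DenseRange h) :
    Cardinal.lift.{v} (dens X) ≤ Cardinal.lift.{u} (Cardinal.mk ι) :=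
  (Cardinal.lift_le.2 (Dense.dens_le hh)).trans Cardinal.mk_range_le_lift

theorem Function.Surjective.lift_dens_le {g : X → Y} (hg : Function.Surjective g)
    (hc : Continuous g) : Cardinal.lift.{u} (dens Y) ≤ Cardinal.lift.{v} (dens X) := by
  obtain ⟨s, hs, hcard⟩ := exists_dense_mk_eq_dens X
  rw [← hcard]
  have : DenseRange (fun x : s ↦ g x) := hg.denseRange.comp hs.denseRange_val hc
  exact this.lift_dens_le

/-- A continuous map is density-surjective if some set that it maps onto the target contains a
dense family indexed by a set realizing the density character of the target. -/
theorem densitySurjective_of_denselyIndexed {f : X → Y} (hf : Continuous f) {D : Set Y}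
    (hD : Cardinal.mk D = dens Y) {Z : Set X} (hZ : DenselyIndexed D Z)
    (hsurj : ∀ y, ∃ x ∈ Z, f x = y) : DensitySurjective f := by
  have hs : Function.Surjective (Z.domRestrict f) := fun y ↦ by
    obtain ⟨x, hx, rfl⟩ := hsurj y
    exact ⟨⟨x, hx⟩, rfl⟩
  refine ⟨Z, le_antisymm ?_ (hs.lift_dens_le (hf.comp continuous_subtype_val)), hs⟩
  obtain ⟨h, h1, h2⟩ := hZ
  rw [← hD]
  have hd : DenseRange (fun i ↦ (⟨h i, h1 (mem_range_self i)⟩ : Z)) := by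
    intro x
    rw [closure_subtype, ← range_comp]
    exact h2 x.2
  exact hd.lift_dens_le

end Density

theorem mainTheorem3
    {E : Type*} [NormedAddCommGroup E] [NormedSpace ℝ E] [CompleteSpace E]
    {F : Type*} [NormedAddCommGroup F] [NormedSpace ℝ F] [CompleteSpace F]
    {M : Type u} [TopologicalSpace M] [ChartedSpace E M] [IsManifold 𝓘(ℝ, E) 1 M]
    [T2Space M] [ParacompactSpace M]
    {N : Type v} [TopologicalSpace N] [ChartedSpace F N] [IsManifold 𝓘(ℝ, F) 1 N]
    [T2Space N] [ParacompactSpace N]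
    (f : M → N) (hf : ContMDiff 𝓘(ℝ, E) 𝓘(ℝ, F) 1 f) (hsurj : Function.Surjective f)
    (hcrit : (criticalValues E F f).Countable) :
    DensitySurjective f := by
  obtain ⟨D, hD, hcard⟩ := exists_dense_mk_eq_dens N
  choose g hg using hsurj
  rcases finite_or_infinite D with hfin | hinf
  · have hDu : D = univ := by
      rw [← hD.closure_eq, (Set.toFinite D).isClosed.closure_eq]
    refine densitySurjective_of_denselyIndexed hf.continuous hcard
      (Z := range fun d : D ↦ g d) ⟨_, Subset.rfl, subset_closure⟩ fun y ↦ ?_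
    exact ⟨g y, ⟨⟨y, hDu ▸ mem_univ y⟩, rfl⟩, hg y⟩
  · have : Nonempty N := ⟨(Classical.arbitrary D : D)⟩
    obtain ⟨h, hh⟩ := (hD.denseRange_val).exists_denseRange_model (F := F)
    obtain ⟨B, hB⟩ := (hD.denseRange_val).exists_network F
    obtain ⟨c, hc⟩ := countable_iff_exists_subset_range.1 hcrit
    obtain ⟨e₁⟩ := Infinite.nonempty_equiv_sum_nat D
    obtain ⟨e₂⟩ := Infinite.nonempty_equiv_prod_self D
    -- One piece is chosen per network set that some piece covers; `{g i}` is only a filler for the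
    -- others.
    have hP : ∀ i : D, ∃ P : Set M, DenselyIndexed D P ∧
        ((∃ Z : Set M, DenselyIndexed D Z ∧ B i ⊆ f '' Z) → B i ⊆ f '' P) := by
      intro i
      by_cases hi : ∃ Z : Set M, DenselyIndexed D Z ∧ B i ⊆ f '' Z
      · obtain ⟨Z, hZ, hZi⟩ := hi
        exact ⟨Z, hZ, fun _ ↦ hZi⟩
      · exact ⟨{g i}, denselyIndexed_singleton _, fun hi' ↦ absurd hi' hi⟩
    choose P hP1 hP2 using hP
    let Q : D ⊕ ℕ → Set M := Sum.elim P fun n ↦ {g (c n)}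
    have hQ : ∀ i, DenselyIndexed D (Q i) := by
      rintro (i | n)
      exacts [hP1 i, denselyIndexed_singleton _]
    refine densitySurjective_of_denselyIndexed hf.continuous hcard
      (DenselyIndexed.iUnion hQ (e₂.trans (e₁.prodCongr (Equiv.refl D)))) fun y ↦ ?_
    by_cases hy : y ∈ criticalValues E F f
    · obtain ⟨n, rfl⟩ := hc hy
      exact ⟨g (c n), mem_iUnion.2 ⟨Sum.inr n, rfl⟩, hg _⟩
    · have hreg : IsRegularPoint E F f (g y) := not_not.1 hy (g y) (hg y)
      obtain ⟨Z, hZ, hZn⟩ := hreg.exists_denselyIndexed hf.contMDiffAt hh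
      rw [hg] at hZn
      obtain ⟨i, hyi, hi⟩ := hB y _ hZn
      obtain ⟨x, hx, hxy⟩ := hP2 i ⟨Z, hZ, hi⟩ hyi
      exact ⟨x, mem_iUnion.2 ⟨Sum.inl i, hx⟩, hxy⟩
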